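/- There exist absolute constants \(C_0, C_1, C_2 > 0\) such that the following holds. Let \(\alpha,\beta,r\in\mathbb{R}\) and integers \(d_1,d_2\ge 1\) satisfy \(\beta\ge 1\), \(\alpha\ge 2\beta\), \(r\ge 4\) and \(\alpha^2 r\max\{d_1,d_2\}\ge C_0\). Let \(\mathcal{S}\) be the set of matrices \(X\in\mathbb{R}^{d_1\times d_2}\) with positive entries such that \(\beta\le X_{ij}\le\alpha\) for all \(i,j\) and \(\|X\|_*\le\alpha\sqrt{r d_1 d_2}\), where \(\|X\|_*\) is the nuclear norm (the sum of the singular values). Let \(\Omega_0\subset\{1,\dots,d_1\}\times\{1,\dots,d_2\}\) be an arbitrary fixed set with \(|\Omega_0|=m\). For \(M\in\mathcal{S}\), let the observations \(Y=(Y_{ij})_{(i,j)\in\Omega_0}\) be mutually independent with \(Y_{ij}\sim\mathrm{Poisson}(M_{ij})\). Put \[ \varepsilon^2 = \min\left\{\frac{1}{256},\; C_2\,\alpha^{3/2}\left[\frac{r\max\{d_1,d_2\}}{m}\right]^{1/2}\right\} \] (for \(m=0\) the second term is read as \(+\infty\)), and suppose that \(\varepsilon^2 > C_1 r\alpha^2/\min\{d_1,d_2\}\).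 Then for every estimator \(\widehat{M}=\widehat{M}(Y)\in\mathbb{R}^{d_1\times d_2}\), that is, every function of the observations, there exists \(M\in\mathcal{S}\) such that, with probability at least \(3/4\) over the random Poisson observations, \[ \frac{1}{d_1 d_2}\,\|M-\widehat{M}\|_F^2 \;\ge\; \varepsilon^2 , \] where \(\|\cdot\|_F\) is the Frobenius norm. -/

import Mathlib

open MeasureTheory ProbabilityTheory

namespace PoissonCompletion

noncomputable section

/-- The nuclear norm of a real matrix: the sum of its singular values, that is, of the singular
values of the linear map `ℝ^{d₂} → ℝ^{d₁}` between Euclidean spaces that it represents. The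
sequence of singular values of that map vanishes from the index `d₂` on. -/
def nuclearNorm {d₁ d₂ : ℕ} (X : Matrix (Fin d₁) (Fin d₂) ℝ) : ℝ :=
  ∑ k : Fin d₂, (Matrix.toEuclideanLin X).singularValues k

/-- The Frobenius norm of a real matrix. -/
def frobeniusNorm {d₁ d₂ : ℕ} (X : Matrix (Fin d₁) (Fin d₂) ℝ) : ℝ :=
  √(∑ i, ∑ j, X i j ^ 2)

/-- The risk `R(M, M̂) = ‖M - M̂‖_F²`. -/
def risk {d₁ d₂ : ℕ} (M Mhat : Matrix (Fin d₁) (Fin d₂) ℝ) : ℝ :=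
  frobeniusNorm (M - Mhat) ^ 2

/-- The class `𝒮` of matrices with positive entries, all of them between `β` and `α`, and with
nuclear norm at most `α √(r d₁ d₂)`. -/
def candidateSet (α β r : ℝ) (d₁ d₂ : ℕ) : Set (Matrix (Fin d₁) (Fin d₂) ℝ) :=
  {X | (∀ i j, 0 < X i j) ∧ nuclearNorm X ≤ α * √(r * d₁ * d₂) ∧
    ∀ i j, β ≤ X i j ∧ X i j ≤ α}

/-- The joint law of the observations `(Y_{ij})_{(i,j) ∈ Ω}`, which are mutually independent with
`Y_{ij} ∼ Poisson(M_{ij})`. -/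
def observationLaw {d₁ d₂ : ℕ} (M : Matrix (Fin d₁) (Fin d₂) ℝ)
    (Ω : Finset (Fin d₁ × Fin d₂)) : Measure (Ω → ℕ) :=
  Measure.pi fun p => poissonMeasure (M p.1.1 p.1.2).toNNReal

/-- The quantity `min {1/256, C₂ α^{3/2} (r max(d₁,d₂) / m)^{1/2}}`. For `m = 0` the second entry
of the minimum is read as `+∞`. -/
def errorFloor (C₂ α r : ℝ) (d₁ d₂ m : ℕ) : ℝ :=
  if m = 0 then 1 / 256
  else min (1 / 256) (C₂ * α ^ (3 / 2 : ℝ) * (r * (max d₁ d₂ : ℕ) / m) ^ (1 / 2 : ℝ))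

end

end PoissonCompletion

namespace PoissonCompletion

/-! Write `ε²` for the floor and put `c = α - 4ε`, `δ = 4ε`. The hard instances have entries `c ±
δ`, with signs repeated along the shorter side in `B` groups, so a pattern has `n = B * max d₁ d₂`
free bits. Such a matrix is a rank-one constant plus a product through dimension `B`. Its nuclear
norm is therefore at most `√(d₁ d₂) (c + δ √B)`, which permits `B` of order `r α² / ε²`.

The whole sign cube is used, with no packing set. For a fixed observation `y`, all patterns that
`Mhat y` approximates within `ε²` lie in one Hamming ball of radius `n / 8`, hence number at most `2
^ n * exp (-n / 4)` (`card_hammingDist_le`). Under the reference law with constant mean `c`, success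
thus has average probability at most `exp (-n / 4)`. Passing to the true law costs a second moment
`exp (m δ² / c)` of the likelihood ratio (`pi_poissonMeasure_real_le`). The second entry of the
floor makes `m δ² / c` small against `n`, so some pattern is recovered with probability at most `1 /
4`. -/

lemma integrable_pow_poissonMeasure (r : NNReal) (c : ℝ) :
    Integrable (fun n : ℕ => c ^ n) (poissonMeasure r) := by
  rw [integrable_poissonMeasure_iff]
  have h := (NormedSpace.expSeries_div_summable (𝔸 := ℝ) ((r : ℝ) * |c|)).mul_left (Real.exp (-r))
  refine h.congr fun n => ?_
  rw [Real.norm_eq_abs, abs_pow, mul_pow]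
  ring

lemma integral_pow_poissonMeasure (r : NNReal) (c : ℝ) :
    ∫ n : ℕ, c ^ n ∂(poissonMeasure r) = Real.exp (r * (c - 1)) := by
  rw [integral_poissonMeasure]
  have h := (NormedSpace.expSeries_div_hasSum_exp ((r : ℝ) * c)).mul_left (Real.exp (-r))
  rw [← Real.exp_eq_exp_ℝ, ← Real.exp_add] at h
  rw [show (r : ℝ) * (c - 1) = -r + r * c by ring, ← h.tsum_eq]
  refine tsum_congr fun n => ?_
  rw [smul_eq_mul, mul_pow]
  ring

/-! ### Likelihood ratios of Poisson products -/

section ChangeOfMeasure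

variable {ι : Type*} [Fintype ι]

/-- The likelihood ratio of two products of Poisson laws. -/
noncomputable def likelihoodRatio (p q : ι → NNReal) (y : ι → ℕ) : ℝ :=
  ∏ i, Real.exp (q i - p i) * ((p i : ℝ) / q i) ^ y i

lemma likelihoodRatio_nonneg (p q : ι → NNReal) (y : ι → ℕ) : 0 ≤ likelihoodRatio p q y :=
  Finset.prod_nonneg fun i _ => by positivity

lemma pi_poissonMeasure_eq_withDensity (p q : ι → NNReal) (hq : ∀ i, 0 < q i) :
    Measure.pi (fun i => poissonMeasure (p i)) =
      (Measure.pi fun i => poissonMeasure (q i)).withDensity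
        fun y => ENNReal.ofReal (likelihoodRatio p q y) := by
  refine Measure.ext_of_singleton fun y => ?_
  rw [withDensity_apply _ (MeasurableSet.singleton y), lintegral_singleton,
    Measure.pi_singleton, Measure.pi_singleton, likelihoodRatio,
    ENNReal.ofReal_prod_of_nonneg (fun _ _ => by positivity), ← Finset.prod_mul_distrib]
  refine Finset.prod_congr rfl fun i _ => ?_
  rw [poissonMeasure_singleton, poissonMeasure_singleton, ← ENNReal.ofReal_mul (by positivity)]
  congr 1
  have h : (q i : ℝ) ≠ 0 := by exact_mod_cast (hq i).ne'
  rw [div_pow, Real.exp_sub, Real.exp_neg, Real.exp_neg]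
  field_simp

lemma integrable_likelihoodRatio (p q : ι → NNReal) :
    Integrable (likelihoodRatio p q) (Measure.pi fun i => poissonMeasure (q i)) :=
  Integrable.fintype_prod (f := fun i (n : ℕ) => Real.exp (q i - p i) * ((p i : ℝ) / q i) ^ n)
    fun _ => (integrable_pow_poissonMeasure _ _).const_mul _

lemma sq_likelihoodRatio (p q : ι → NNReal) (y : ι → ℕ) :
    likelihoodRatio p q y ^ 2 =
      ∏ i, Real.exp (2 * (q i - p i)) * (((p i : ℝ) / q i) ^ 2) ^ y i := by
  rw [likelihoodRatio, ← Finset.prod_pow]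
  refine Finset.prod_congr rfl fun i _ => ?_
  rw [mul_pow, two_mul, Real.exp_add]
  ring

lemma integrable_sq_likelihoodRatio (p q : ι → NNReal) :
    Integrable (fun y => likelihoodRatio p q y ^ 2)
      (Measure.pi fun i => poissonMeasure (q i)) := by
  simp_rw [sq_likelihoodRatio]
  exact Integrable.fintype_prod
    (f := fun i (n : ℕ) => Real.exp (2 * (q i - p i)) * (((p i : ℝ) / q i) ^ 2) ^ n)
    fun i => (integrable_pow_poissonMeasure _ _).const_mul _

lemma integral_sq_likelihoodRatio (p q : ι → NNReal) (hq : ∀ i, 0 < q i) :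
    ∫ y, likelihoodRatio p q y ^ 2 ∂(Measure.pi fun i => poissonMeasure (q i)) =
      Real.exp (∑ i, ((p i : ℝ) - q i) ^ 2 / q i) := by
  simp_rw [sq_likelihoodRatio]
  rw [integral_fintype_prod_eq_prod
    (f := fun i (n : ℕ) => Real.exp (2 * (q i - p i)) * (((p i : ℝ) / q i) ^ 2) ^ n),
    Real.exp_sum]
  refine Finset.prod_congr rfl fun i _ => ?_
  rw [integral_const_mul, integral_pow_poissonMeasure, ← Real.exp_add]
  congr 1
  have h : (q i : ℝ) ≠ 0 := by exact_mod_cast (hq i).ne'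
  field_simp
  ring

/-- A change of measure bound between products of Poisson laws through their `χ²`-divergence. -/
lemma pi_poissonMeasure_real_le (p q : ι → NNReal) (hq : ∀ i, 0 < q i) (A : Set (ι → ℕ))
    {t : ℝ} (ht : 0 < t) :
    (Measure.pi fun i => poissonMeasure (p i)).real A ≤
      t / 2 * Real.exp (∑ i, ((p i : ℝ) - q i) ^ 2 / q i) +
        (Measure.pi fun i => poissonMeasure (q i)).real A / (2 * t) := by
  set Q := Measure.pi fun i => poissonMeasure (q i)
  have hA : MeasurableSet A := A.to_countable.measurableSet
  have hP : (Measure.pi fun i => poissonMeasure (p i)).real A =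
      ∫ y in A, likelihoodRatio p q y ∂Q := by
    rw [measureReal_def, pi_poissonMeasure_eq_withDensity p q hq, withDensity_apply _ hA,
      integral_eq_lintegral_of_nonneg_ae (.of_forall fun y => likelihoodRatio_nonneg p q y)
        (integrable_likelihoodRatio p q).aestronglyMeasurable.restrict]
  -- AM-GM, with the weight `t` left free to balance the two terms later.
  have hle : ∫ y in A, likelihoodRatio p q y ∂Q ≤
      ∫ y in A, (t / 2 * likelihoodRatio p q y ^ 2 + 1 / (2 * t)) ∂Q := by
    refine integral_mono (integrable_likelihoodRatio p q).integrableOn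
      (((integrable_sq_likelihoodRatio p q).const_mul _).add (integrable_const _)).integrableOn
      fun y => ?_
    have h2 : t / 2 * likelihoodRatio p q y ^ 2 + 1 / (2 * t) - likelihoodRatio p q y =
        (t * likelihoodRatio p q y - 1) ^ 2 / (2 * t) := by
      field_simp
      ring
    have h3 : 0 ≤ (t * likelihoodRatio p q y - 1) ^ 2 / (2 * t) := by positivity
    simp only
    linarith
  have hsq : ∫ y in A, likelihoodRatio p q y ^ 2 ∂Q ≤
      Real.exp (∑ i, ((p i : ℝ) - q i) ^ 2 / q i) := by
    rw [← integral_sq_likelihoodRatio p q hq]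
    exact setIntegral_le_integral (integrable_sq_likelihoodRatio p q)
      (.of_forall fun y => sq_nonneg _)
  rw [hP]
  refine hle.trans ?_
  rw [integral_add ((integrable_sq_likelihoodRatio p q).const_mul _).integrableOn
    (integrable_const _).integrableOn, integral_const_mul, setIntegral_const, smul_eq_mul,
    mul_one_div]
  gcongr

end ChangeOfMeasure

/-! ### From counting successes to a bad parameter -/

section Testing

variable {Y S : Type*} [MeasurableSpace Y] [Fintype S]

/-- Double counting: the sum is the `Q`-mean of the number of sets containing `y`. -/
lemma sum_measureReal_le_of_card_le (Q : Measure Y) [IsProbabilityMeasure Q] (A : S → Set Y)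
    (hA : ∀ s, MeasurableSet (A s)) {N : ℝ}
    (hN : ∀ y, (Nat.card {s // y ∈ A s} : ℝ) ≤ N) : ∑ s, Q.real (A s) ≤ N := by
  classical
  have h : ∑ s, Q.real (A s) = ∫ y, ∑ s, (A s).indicator (fun _ => (1 : ℝ)) y ∂Q := by
    rw [integral_finsetSum _ fun s _ => (integrable_const (1 : ℝ)).indicator (hA s)]
    refine Finset.sum_congr rfl fun s _ => ?_
    rw [integral_indicator_const _ (hA s), smul_eq_mul, mul_one]
  rw [h]
  calc _ ≤ ∫ _, N ∂Q := by
        refine integral_mono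
          (integrable_finsetSum _ fun s _ => (integrable_const (1 : ℝ)).indicator (hA s))
          (integrable_const _) fun y => ?_
        refine le_trans (le_of_eq ?_) (hN y)
        simp [Set.indicator_apply, Nat.card_eq_fintype_card, Fintype.card_subtype]
    _ = N := by simp

lemma exists_measureReal_le_quarter [Nonempty S] (P : S → Measure Y) (Q : Measure Y)
    [IsProbabilityMeasure Q] (A : S → Set Y) (hA : ∀ s, MeasurableSet (A s)) {V N : ℝ}
    (hV : 0 < V)
    (hP : ∀ s, ∀ t : ℝ, 0 < t → (P s).real (A s) ≤ t / 2 * V + Q.real (A s) / (2 * t))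
    (hN : ∀ y, (Nat.card {s // y ∈ A s} : ℝ) ≤ N) (hVN : 16 * (V * N) ≤ Fintype.card S) :
    ∃ s, (P s).real (A s) ≤ 1 / 4 := by
  by_contra! hcon
  have h1 : ∀ s, 1 / 8 < 2 * V * Q.real (A s) := fun s => by
    -- This `t` makes the second-moment term exactly `1 / 8`, half of the assumed `1 / 4`.
    have h := (hcon s).trans_le (hP s (1 / (4 * V)) (by positivity))
    have e : 1 / (4 * V) / 2 * V + Q.real (A s) / (2 * (1 / (4 * V))) =
        1 / 8 + 2 * V * Q.real (A s) := by
      field_simp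
      ring
    linarith
  have h2 : ∑ _s : S, (1 / 8 : ℝ) < ∑ s, 2 * V * Q.real (A s) :=
    Finset.sum_lt_sum_of_nonempty Finset.univ_nonempty fun s _ => h1 s
  rw [← Finset.mul_sum, Finset.sum_const, Finset.card_univ, nsmul_eq_mul] at h2
  have h3 := mul_le_mul_of_nonneg_left (sum_measureReal_le_of_card_le Q A hA hN)
    (by positivity : 0 ≤ 2 * V)
  linarith

end Testing

/-! ### Volume of Hamming balls -/

section Cube

variable {K : Type*} [Fintype K]

/-- A volume bound for Hamming balls of radius an eighth of the dimension. -/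
lemma card_hammingDist_le (s₀ : K → Bool) :
    (Nat.card {s : K → Bool // 8 * hammingDist s s₀ ≤ Fintype.card K} : ℝ) ≤
      2 ^ Fintype.card K * Real.exp (-(Fintype.card K / 4)) := by
  classical
  set n := Fintype.card K
  set T : Finset (K → Bool) := Finset.univ.filter fun s => 8 * hammingDist s s₀ ≤ n
  have hcard : Nat.card {s : K → Bool // 8 * hammingDist s s₀ ≤ n} = T.card := by
    rw [Nat.card_eq_fintype_card, Fintype.card_subtype]
  -- Chernoff bound: the weight `1 / 16` per disagreement factors over coordinates, and inside the
  -- ball the total weight is at least `√2 ^ (-n)`.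
  have hsum : ∑ s : K → Bool, (1 / 16 : ℝ) ^ hammingDist s s₀ = (17 / 16) ^ n := by
    have h := Finset.prod_univ_sum (fun _ : K => (Finset.univ : Finset Bool))
      (fun k b => if b ≠ s₀ k then (1 / 16 : ℝ) else 1)
    rw [Fintype.piFinset_univ] at h
    have e : ∀ k, ∑ b : Bool, (if b ≠ s₀ k then (1 / 16 : ℝ) else 1) = 17 / 16 := fun k => by
      cases s₀ k <;> norm_num
    simp_rw [e] at h
    rw [Finset.prod_const, Finset.card_univ] at h
    rw [h]
    refine Finset.sum_congr rfl fun s _ => ?_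
    rw [Finset.prod_ite, Finset.prod_const, Finset.prod_const_one, mul_one]
    rfl
  have hT : (T.card : ℝ) ^ 2 ≤ (289 / 128) ^ n := by
    have hterm : ∀ s ∈ T, (√2 ^ n)⁻¹ ≤ (1 / 16 : ℝ) ^ hammingDist s s₀ := fun s hs => by
      rw [one_div, inv_pow]
      refine inv_anti₀ (by positivity) ?_
      have e : (16 : ℝ) = √2 ^ 8 := by
        rw [show (8 : ℕ) = 2 * 4 by rfl, pow_mul, Real.sq_sqrt (by norm_num)]
        norm_num
      rw [e, ← pow_mul]
      exact pow_le_pow_right₀ (Real.one_le_sqrt.2 (by norm_num)) (Finset.mem_filter.1 hs).2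
    have h1 : T.card * (√2 ^ n)⁻¹ ≤ (17 / 16 : ℝ) ^ n := by
      rw [← hsum, ← nsmul_eq_mul]
      exact (Finset.card_nsmul_le_sum _ _ _ hterm).trans
        (Finset.sum_le_sum_of_subset_of_nonneg (Finset.subset_univ _) fun s _ _ => by positivity)
    have h2 : (T.card : ℝ) ≤ (17 / 16 * √2) ^ n := by
      rw [mul_pow]
      rwa [← div_eq_mul_inv, div_le_iff₀ (by positivity)] at h1
    calc (T.card : ℝ) ^ 2 ≤ ((17 / 16 * √2) ^ n) ^ 2 := by gcongr
      _ = ((17 / 16 * √2) ^ 2) ^ n := by rw [← pow_mul, ← pow_mul, mul_comm n 2]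
      _ = (289 / 128) ^ n := by
        rw [mul_pow, Real.sq_sqrt (by norm_num)]
        norm_num
  rw [hcard]
  refine le_of_sq_le_sq (hT.trans ?_) (by positivity)
  have e : (2 ^ n * Real.exp (-((n : ℝ) / 4))) ^ 2 = (4 * Real.exp (-(1 / 2))) ^ n := by
    rw [mul_pow, mul_pow, ← Real.exp_nat_mul, ← Real.exp_nat_mul, ← pow_mul, mul_comm n 2, pow_mul]
    norm_num
    ring_nf
  rw [e]
  gcongr
  have h : Real.exp (1 / 2) ≤ 17 / 10 := by
    have h3 : Real.exp (1 / 2) ^ 2 = Real.exp 1 := by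
      rw [← Real.exp_nat_mul]
      norm_num
    have h4 := Real.exp_one_lt_d9
    refine le_of_sq_le_sq ?_ (by norm_num)
    rw [h3]
    linarith
  rw [Real.exp_neg, ← div_eq_mul_inv, le_div_iff₀ (Real.exp_pos _)]
  linarith

end Cube

/-! ### Nuclear norm of a product -/

section NuclearNorm

open scoped InnerProductSpace

variable {d₁ d₂ : ℕ}

lemma sq_frobeniusNorm (X : Matrix (Fin d₁) (Fin d₂) ℝ) :
    frobeniusNorm X ^ 2 = ∑ i, ∑ j, X i j ^ 2 :=
  Real.sq_sqrt (Finset.sum_nonneg fun _ _ => Finset.sum_nonneg fun _ _ => sq_nonneg _)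

lemma inner_toEuclideanLin_mul {n : ℕ} (P : Matrix (Fin d₁) (Fin n) ℝ)
    (Q : Matrix (Fin n) (Fin d₂) ℝ) (u : EuclideanSpace ℝ (Fin d₁))
    (v : EuclideanSpace ℝ (Fin d₂)) :
    ⟪u, Matrix.toEuclideanLin (P * Q) v⟫_ℝ =
      ∑ b, ⟪u, WithLp.toLp 2 fun i => P i b⟫_ℝ * ⟪v, WithLp.toLp 2 fun j => Q b j⟫_ℝ := by
  simp only [PiLp.inner_apply, Matrix.toLpLin_apply, ← Matrix.mulVec_mulVec, Matrix.mulVec,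
    dotProduct, RCLike.inner_apply, conj_trivial, Finset.sum_mul]
  rw [Finset.sum_comm]
  exact Finset.sum_congr rfl fun b _ => Finset.sum_congr rfl fun i _ => by ring

/-- Cauchy–Schwarz over pairs `(k, b)`, then Bessel for each column of `P` and each row of `Q`. -/
lemma sum_inner_toEuclideanLin_mul_le {ι : Type*} [Fintype ι] {n : ℕ}
    {u : ι → EuclideanSpace ℝ (Fin d₁)} {v : ι → EuclideanSpace ℝ (Fin d₂)}
    (hu : Orthonormal ℝ u) (hv : Orthonormal ℝ v)
    (P : Matrix (Fin d₁) (Fin n) ℝ) (Q : Matrix (Fin n) (Fin d₂) ℝ) :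
    ∑ k, ⟪u k, Matrix.toEuclideanLin (P * Q) (v k)⟫_ℝ ≤ frobeniusNorm P * frobeniusNorm Q := by
  simp_rw [inner_toEuclideanLin_mul]
  rw [← Fintype.sum_prod_type'
    (f := fun k b => ⟪u k, WithLp.toLp 2 fun i => P i b⟫_ℝ * ⟪v k, WithLp.toLp 2 fun j => Q b j⟫_ℝ)]
  refine (Real.sum_mul_le_sqrt_mul_sqrt _ _ _).trans ?_
  refine mul_le_mul (Real.sqrt_le_sqrt ?_) (Real.sqrt_le_sqrt ?_) (Real.sqrt_nonneg _)
    (Real.sqrt_nonneg _)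
  · rw [Fintype.sum_prod_type_right, Finset.sum_comm (s := Finset.univ (α := Fin d₁))]
    refine Finset.sum_le_sum fun b _ => ?_
    have h := hu.sum_inner_products_le (s := Finset.univ) (WithLp.toLp 2 fun i => P i b)
    simpa [EuclideanSpace.norm_sq_eq] using h
  · rw [Fintype.sum_prod_type_right]
    refine Finset.sum_le_sum fun b _ => ?_
    have h := hv.sum_inner_products_le (s := Finset.univ) (WithLp.toLp 2 fun j => Q b j)
    simpa [EuclideanSpace.norm_sq_eq] using h

/-- The nuclear norm is attained by pairing with two orthonormal families. -/
lemma exists_orthonormal_nuclearNorm_eq (X : Matrix (Fin d₁) (Fin d₂) ℝ) :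
    ∃ (s : Finset (Fin d₂)) (u : s → EuclideanSpace ℝ (Fin d₁))
      (v : s → EuclideanSpace ℝ (Fin d₂)), Orthonormal ℝ u ∧ Orthonormal ℝ v ∧
      nuclearNorm X = ∑ k, ⟪u k, Matrix.toEuclideanLin X (v k)⟫_ℝ := by
  classical
  set T := Matrix.toEuclideanLin X
  have hn : Module.finrank ℝ (EuclideanSpace ℝ (Fin d₂)) = d₂ := by simp
  set b := T.isSymmetric_adjoint_comp_self.eigenvectorBasis hn
  set σ : Fin d₂ → ℝ := fun k => T.singularValues k
  have hT : ∀ k l, ⟪T (b k), T (b l)⟫_ℝ = if k = l then σ k ^ 2 else 0 := fun k l => by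
    rw [← LinearMap.adjoint_inner_right, ← LinearMap.comp_apply,
      T.isSymmetric_adjoint_comp_self.apply_eigenvectorBasis, inner_smul_right,
      ← T.sq_singularValues_fin hn, orthonormal_iff_ite.1 b.orthonormal k l]
    split_ifs with h
    · subst h
      simp [σ]
    · simp
  -- Only nonzero singular values give a normalised left vector; the others contribute nothing to
  -- the sum.
  refine ⟨Finset.univ.filter fun k => σ k ≠ 0, fun k => (σ k)⁻¹ • T (b k), fun k => b k, ?_,
    b.orthonormal.comp _ Subtype.val_injective, ?_⟩
  · rw [orthonormal_iff_ite]
    rintro ⟨k, hk⟩ ⟨l, hl⟩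
    have hk' : σ k ≠ 0 := (Finset.mem_filter.1 hk).2
    rw [real_inner_smul_left, real_inner_smul_right, hT]
    simp only [Subtype.mk.injEq]
    split_ifs with h
    · subst h
      field_simp
    · simp
  · rw [Finset.sum_coe_sort (Finset.univ.filter fun k => σ k ≠ 0)
      (fun k => ⟪(σ k)⁻¹ • T (b k), T (b k)⟫_ℝ), Finset.sum_filter]
    refine Finset.sum_congr rfl fun k _ => ?_
    change σ k = _
    split_ifs with h
    · rw [real_inner_smul_left, hT, if_pos rfl]
      field_simp
    · exact not_not.1 h

/-- Both products are tested against the same orthonormal families, which replaces the triangle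
inequality. -/
lemma nuclearNorm_mul_add_mul_le {n₁ n₂ : ℕ} (P₁ : Matrix (Fin d₁) (Fin n₁) ℝ)
    (Q₁ : Matrix (Fin n₁) (Fin d₂) ℝ) (P₂ : Matrix (Fin d₁) (Fin n₂) ℝ)
    (Q₂ : Matrix (Fin n₂) (Fin d₂) ℝ) :
    nuclearNorm (P₁ * Q₁ + P₂ * Q₂) ≤
      frobeniusNorm P₁ * frobeniusNorm Q₁ + frobeniusNorm P₂ * frobeniusNorm Q₂ := by
  obtain ⟨s, u, v, hu, hv, h⟩ := exists_orthonormal_nuclearNorm_eq (P₁ * Q₁ + P₂ * Q₂)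
  rw [h]
  simp only [map_add, LinearMap.add_apply, inner_add_right, Finset.sum_add_distrib]
  exact add_le_add (sum_inner_toEuclideanLin_mul_le hu hv P₁ Q₁)
    (sum_inner_toEuclideanLin_mul_le hu hv P₂ Q₂)

end NuclearNorm

/-! ### The sign family and its testing bound -/

section SignMatrix

variable {d₁ d₂ : ℕ} {K : Type*}

/-- The matrix with entries `c + δ` and `c - δ`, whose pattern is given by a sign vector `s` and an
assignment `φ` of the entries to the coordinates of `s`. -/
def signMatrix (φ : Fin d₁ × Fin d₂ → K) (c δ : ℝ) (s : K → Bool) :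
    Matrix (Fin d₁) (Fin d₂) ℝ :=
  fun i j => c + if s (φ (i, j)) then δ else -δ

lemma sq_frobeniusNorm_signMatrix_sub (φ : Fin d₁ × Fin d₂ → K) (c δ : ℝ) (s t : K → Bool) :
    frobeniusNorm (signMatrix φ c δ s - signMatrix φ c δ t) ^ 2 =
      ∑ p, if s (φ p) ≠ t (φ p) then 4 * δ ^ 2 else 0 := by
  rw [sq_frobeniusNorm, Fintype.sum_prod_type]
  refine Finset.sum_congr rfl fun i _ => Finset.sum_congr rfl fun j _ => ?_
  simp only [signMatrix, Matrix.sub_apply]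
  cases s (φ (i, j)) <;> cases t (φ (i, j)) <;> simp <;> ring

lemma mul_hammingDist_le_sq_frobeniusNorm [Fintype K] [DecidableEq K] (φ : Fin d₁ × Fin d₂ → K)
    {N : ℕ} (hφ : ∀ k, d₁ * d₂ ≤ N * (Finset.univ.filter fun p => φ p = k).card)
    (c δ : ℝ) (s t : K → Bool) :
    4 * δ ^ 2 * (d₁ * d₂) * hammingDist s t ≤
      N * frobeniusNorm (signMatrix φ c δ s - signMatrix φ c δ t) ^ 2 := by
  rw [sq_frobeniusNorm_signMatrix_sub, ← Finset.sum_fiberwise _ φ, Finset.mul_sum]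
  have h1 : (4 * δ ^ 2 * (d₁ * d₂) * hammingDist s t : ℝ) =
      ∑ k, if s k ≠ t k then 4 * δ ^ 2 * (d₁ * d₂) else 0 := by
    rw [← Finset.sum_filter, Finset.sum_const, nsmul_eq_mul, mul_comm]
    rfl
  rw [h1]
  refine Finset.sum_le_sum fun k _ => ?_
  have h2 : ∑ p ∈ Finset.univ.filter (fun p => φ p = k),
      (if s (φ p) ≠ t (φ p) then 4 * δ ^ 2 else 0) =
        ((Finset.univ.filter fun p => φ p = k).card : ℝ) *
          if s k ≠ t k then 4 * δ ^ 2 else 0 := by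
    rw [← nsmul_eq_mul, ← Finset.sum_const]
    refine Finset.sum_congr rfl fun p hp => ?_
    rw [(Finset.mem_filter.1 hp).2]
  rw [h2]
  have h3 : (d₁ * d₂ : ℝ) ≤ N * (Finset.univ.filter fun p => φ p = k).card := by
    exact_mod_cast hφ k
  split_ifs
  · nlinarith [mul_le_mul_of_nonneg_left h3 (by positivity : 0 ≤ 4 * δ ^ 2)]
  · simp

lemma sq_frobeniusNorm_sub_le (X X' Z : Matrix (Fin d₁) (Fin d₂) ℝ) :
    frobeniusNorm (X - X') ^ 2 ≤ 2 * frobeniusNorm (X - Z) ^ 2 + 2 * frobeniusNorm (X' - Z) ^ 2 := by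
  simp only [sq_frobeniusNorm, Finset.mul_sum, ← Finset.sum_add_distrib, Matrix.sub_apply]
  refine Finset.sum_le_sum fun i _ => Finset.sum_le_sum fun j _ => ?_
  nlinarith [sq_nonneg (X i j - Z i j + (X' i j - Z i j))]

instance (M : Matrix (Fin d₁) (Fin d₂) ℝ) (Ω : Finset (Fin d₁ × Fin d₂)) :
    IsProbabilityMeasure (observationLaw M Ω) := by
  unfold observationLaw
  infer_instance

lemma exists_signMatrix_risk_le [Fintype K] [DecidableEq K] (φ : Fin d₁ × Fin d₂ → K)
    (hφ : ∀ k, d₁ * d₂ ≤ 2 * Fintype.card K * (Finset.univ.filter fun p => φ p = k).card)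
    (hd₁ : 0 < d₁) (hd₂ : 0 < d₂) {c ε : ℝ} (hε : 0 < ε) (hc : 4 * ε < c)
    (Ω : Finset (Fin d₁ × Fin d₂))
    (hK : Ω.card * (4 * ε) ^ 2 / c + 3 ≤ (Fintype.card K : ℝ) / 4)
    (Mhat : (Ω → ℕ) → Matrix (Fin d₁) (Fin d₂) ℝ) :
    ∃ s, 3 / 4 ≤ (observationLaw (signMatrix φ c (4 * ε) s) Ω).real
      {y | ε ^ 2 ≤ 1 / ((d₁ : ℝ) * d₂) * risk (signMatrix φ c (4 * ε) s) (Mhat y)} := by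
  set δ := 4 * ε with hδ
  have hδ0 : 0 < δ := by positivity
  have hc0 : 0 < c := hδ0.trans hc
  have hD : (0 : ℝ) < d₁ * d₂ := by positivity
  set n := Fintype.card K
  let A : (K → Bool) → Set (Ω → ℕ) := fun s =>
    {y | ε ^ 2 ≤ 1 / ((d₁ : ℝ) * d₂) * risk (signMatrix φ c δ s) (Mhat y)}ᶜ
  have hA : ∀ s, MeasurableSet (A s) := fun s => (A s).to_countable.measurableSet
  have hmem : ∀ s y, y ∈ A s ↔
      frobeniusNorm (signMatrix φ c δ s - Mhat y) ^ 2 < ε ^ 2 * (d₁ * d₂) := fun s y => by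
    simp only [A, risk, Set.mem_compl_iff, Set.mem_ofPred_eq, not_le, one_div_mul_eq_div]
    rw [div_lt_iff₀ hD]
  obtain ⟨s, hs⟩ := exists_measureReal_le_quarter
    (P := fun s => observationLaw (signMatrix φ c δ s) Ω)
    (Q := observationLaw (Matrix.of fun _ _ => c : Matrix (Fin d₁) (Fin d₂) ℝ) Ω) A hA
    (V := Real.exp (Ω.card * δ ^ 2 / c)) (N := 2 ^ n * Real.exp (-(n / 4))) (Real.exp_pos _)
    (fun s t ht => by
      have h := pi_poissonMeasure_real_le
        (fun p : Ω => (signMatrix φ c δ s p.1.1 p.1.2).toNNReal) (fun _ : Ω => c.toNNReal)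
        (fun _ => Real.toNNReal_pos.2 hc0) (A s) ht
      have e : ∑ p : Ω, (((signMatrix φ c δ s p.1.1 p.1.2).toNNReal : ℝ) - c.toNNReal) ^ 2 /
          c.toNNReal = Ω.card * δ ^ 2 / c := by
        rw [Real.coe_toNNReal _ hc0.le, mul_div_assoc, ← Fintype.card_coe Ω, ← nsmul_eq_mul,
          ← Finset.card_univ, ← Finset.sum_const]
        refine Finset.sum_congr rfl fun p _ => ?_
        rw [Real.coe_toNNReal]
        · congr 1
          simp only [signMatrix]
          split_ifs <;> ring
        · simp only [signMatrix]
          split_ifs <;> linarith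
      rw [e] at h
      exact h)
    (fun y => by
      by_cases hy : ∃ s₀, y ∈ A s₀
      · obtain ⟨s₀, hs₀⟩ := hy
        refine le_trans ?_ (card_hammingDist_le s₀)
        -- Any one successful pattern serves as centre. Two successes are within `4 ε² d₁ d₂` in
        -- squared norm, while each differing bit accounts for at least `4 δ² d₁ d₂ / (2 n)`; with
        -- `δ = 4 ε` this gives radius `n / 8`.
        have hsub : {s | y ∈ A s} ⊆ {s : K → Bool | 8 * hammingDist s s₀ ≤ n} := fun s hs => by
          have h1 := mul_hammingDist_le_sq_frobeniusNorm φ hφ c δ s s₀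
          have h2 := sq_frobeniusNorm_sub_le (signMatrix φ c δ s) (signMatrix φ c δ s₀) (Mhat y)
          rw [hmem] at hs₀
          have h3 := (hmem _ _).1 hs
          have h4 : ε ^ 2 * (d₁ * d₂) * (8 * hammingDist s s₀) ≤ ε ^ 2 * (d₁ * d₂) * n := by
            have h5 : frobeniusNorm (signMatrix φ c δ s - signMatrix φ c δ s₀) ^ 2 ≤
              4 * (ε ^ 2 * (d₁ * d₂)) := by linarith
            have h6 := mul_le_mul_of_nonneg_left h5 (by positivity : (0 : ℝ) ≤ (2 * n : ℕ))
            rw [hδ] at h1 h6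
            push_cast at h1 h6
            nlinarith
          have h7 := le_of_mul_le_mul_left h4 (by positivity)
          exact_mod_cast h7
        exact_mod_cast Nat.card_mono (Set.toFinite _) hsub
      · have : IsEmpty {s // y ∈ A s} := ⟨fun s => hy ⟨s.1, s.2⟩⟩
        rw [Nat.card_of_isEmpty, Nat.cast_zero]
        positivity)
    (by
      -- The `3` in `hK` absorbs the factor `16` of the testing lemma.
      have h16 : (16 : ℝ) ≤ Real.exp 3 := by
        have h := Real.exp_one_gt_d9
        have e : Real.exp 3 = Real.exp 1 ^ 3 := by
          rw [← Real.exp_nat_mul]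
          norm_num
        rw [e]
        calc (16 : ℝ) ≤ 2.7 ^ 3 := by norm_num
          _ ≤ Real.exp 1 ^ 3 := by gcongr; linarith
      have h1 : 16 * (Real.exp (Ω.card * δ ^ 2 / c) * Real.exp (-(n / 4))) ≤ 1 := by
        calc _ ≤ Real.exp 3 * (Real.exp (Ω.card * δ ^ 2 / c) * Real.exp (-(n / 4))) := by gcongr
          _ = Real.exp (3 + (Ω.card * δ ^ 2 / c + -(n / 4))) := by rw [Real.exp_add, Real.exp_add]
          _ ≤ 1 := Real.exp_le_one_iff.2 (by linarith)
      have h2 : (0 : ℝ) < 2 ^ n := by positivity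
      simp only [Fintype.card_pi, Fintype.card_bool, Finset.prod_const, Finset.card_univ]
      push_cast
      change _ ≤ (2 : ℝ) ^ n
      nlinarith)
  refine ⟨s, ?_⟩
  have h := probReal_compl_eq_one_sub (μ := observationLaw (signMatrix φ c δ s) Ω) (hA s)
  simp only [A, compl_compl] at h
  rw [h]
  linarith

end SignMatrix

/-! ### Block patterns of small nuclear norm -/

section Coding

/-- Residues modulo `B` have fibres of size at least `d / B`; rounding costs a factor below two
because `d / B ≥ 1`. -/
lemma exists_balanced_map {d B : ℕ} (hB : 0 < B) (hBd : B ≤ d) :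
    ∃ f : Fin d → Fin B, ∀ a, d ≤ 2 * B * (Finset.univ.filter fun i => f i = a).card := by
  refine ⟨fun i => ⟨i % B, Nat.mod_lt _ hB⟩, fun a => ?_⟩
  have h1 : d / B ≤ (Finset.univ.filter fun i : Fin d =>
      (⟨i % B, Nat.mod_lt _ hB⟩ : Fin B) = a).card := by
    have hlt : ∀ q : Fin (d / B), a + B * q < d := fun q => by
      have h2 := Nat.mul_le_mul_left B (Nat.succ_le_of_lt q.2)
      have h3 := Nat.mul_div_le d B
      have h4 := a.2
      rw [Nat.mul_succ] at h2
      omega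
    have h := Finset.card_le_card_of_injOn (s := (Finset.univ : Finset (Fin (d / B))))
      (t := Finset.univ.filter fun i : Fin d => (⟨i % B, Nat.mod_lt _ hB⟩ : Fin B) = a)
      (fun q => ⟨a + B * q, hlt q⟩)
      (fun q _ => by simp [Fin.ext_iff, Nat.mod_eq_of_lt a.2])
      (fun q _ q' _ h => by
        simp only [Fin.mk.injEq] at h
        exact Fin.ext (Nat.eq_of_mul_eq_mul_left hB (by omega)))
    simpa using h
  have h2 := Nat.lt_mul_div_succ d hB
  have h3 : 1 ≤ d / B := Nat.div_pos hBd hB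
  nlinarith

variable {d₁ d₂ B : ℕ}

lemma frobeniusNorm_eq_of_sq_eq {X : Matrix (Fin d₁) (Fin d₂) ℝ} {a : ℝ} (ha : 0 ≤ a)
    (h : ∀ i j, X i j ^ 2 = a ^ 2) : frobeniusNorm X = a * √(d₁ * d₂) := by
  rw [frobeniusNorm]
  simp only [h, Finset.sum_const, Finset.card_univ, Fintype.card_fin, nsmul_eq_mul]
  rw [← mul_assoc, mul_comm, Real.sqrt_mul (sq_nonneg a), Real.sqrt_sq ha]

lemma frobeniusNorm_const {c : ℝ} (hc : 0 ≤ c) :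
    frobeniusNorm (Matrix.of fun _ _ => c : Matrix (Fin d₁) (Fin d₂) ℝ) = c * √(d₁ * d₂) :=
  frobeniusNorm_eq_of_sq_eq hc fun _ _ => rfl

lemma frobeniusNorm_indicator_row (f : Fin d₁ → Fin B) :
    frobeniusNorm (Matrix.of fun i a => if f i = a then 1 else 0) = √d₁ := by
  simp [frobeniusNorm]

lemma frobeniusNorm_indicator_col (f : Fin d₂ → Fin B) :
    frobeniusNorm (Matrix.of fun a j => if f j = a then 1 else 0) = √d₂ := by
  rw [frobeniusNorm, Finset.sum_comm]
  simp

lemma frobeniusNorm_signs {δ : ℝ} (hδ : 0 ≤ δ) (s : Fin d₁ × Fin d₂ → Bool) :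
    frobeniusNorm (Matrix.of fun i j => if s (i, j) then δ else -δ) = δ * √(d₁ * d₂) :=
  frobeniusNorm_eq_of_sq_eq hδ fun i j => by
    rw [Matrix.of_apply]
    split_ifs <;> simp

lemma nuclearNorm_signMatrix_row_le (f : Fin d₁ → Fin B) {c δ : ℝ} (hc : 0 ≤ c) (hδ : 0 ≤ δ)
    (s : Fin B × Fin d₂ → Bool) :
    nuclearNorm (signMatrix (fun p => (f p.1, p.2)) c δ s) ≤ √(d₁ * d₂) * (c + δ * √B) := by
  have e : signMatrix (fun p => (f p.1, p.2)) c δ s =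
      (Matrix.of fun _ _ => 1 : Matrix (Fin d₁) (Fin 1) ℝ) *
          (Matrix.of fun _ _ => c : Matrix (Fin 1) (Fin d₂) ℝ) +
        (Matrix.of fun i a => if f i = a then 1 else 0 : Matrix (Fin d₁) (Fin B) ℝ) *
          (Matrix.of fun a j => if s (a, j) then δ else -δ : Matrix (Fin B) (Fin d₂) ℝ) := by
    ext i j
    rw [Matrix.add_apply, Matrix.mul_apply, Matrix.mul_apply]
    simp only [Matrix.of_apply, ite_mul, one_mul, zero_mul, Finset.sum_ite_eq, Finset.mem_univ, if_true]
    simp [signMatrix]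
  rw [e]
  refine (nuclearNorm_mul_add_mul_le _ _ _ _).trans (le_of_eq ?_)
  rw [frobeniusNorm_const zero_le_one, frobeniusNorm_const hc, frobeniusNorm_indicator_row, frobeniusNorm_signs hδ,
    Nat.cast_one, one_mul, one_mul, mul_one, Real.sqrt_mul (Nat.cast_nonneg _),
    Real.sqrt_mul (Nat.cast_nonneg _)]
  ring

lemma nuclearNorm_signMatrix_col_le (f : Fin d₂ → Fin B) {c δ : ℝ} (hc : 0 ≤ c) (hδ : 0 ≤ δ)
    (s : Fin d₁ × Fin B → Bool) :
    nuclearNorm (signMatrix (fun p => (p.1, f p.2)) c δ s) ≤ √(d₁ * d₂) * (c + δ * √B) := by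
  have e : signMatrix (fun p => (p.1, f p.2)) c δ s =
      (Matrix.of fun _ _ => 1 : Matrix (Fin d₁) (Fin 1) ℝ) *
          (Matrix.of fun _ _ => c : Matrix (Fin 1) (Fin d₂) ℝ) +
        (Matrix.of fun i a => if s (i, a) then δ else -δ : Matrix (Fin d₁) (Fin B) ℝ) *
          (Matrix.of fun a j => if f j = a then 1 else 0 : Matrix (Fin B) (Fin d₂) ℝ) := by
    ext i j
    rw [Matrix.add_apply, Matrix.mul_apply, Matrix.mul_apply]
    simp only [Matrix.of_apply, mul_ite, mul_one, mul_zero, Finset.sum_ite_eq, Finset.mem_univ, if_true]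
    simp [signMatrix]
  rw [e]
  refine (nuclearNorm_mul_add_mul_le _ _ _ _).trans (le_of_eq ?_)
  rw [frobeniusNorm_const zero_le_one, frobeniusNorm_const hc, frobeniusNorm_indicator_col, frobeniusNorm_signs hδ,
    Nat.cast_one, one_mul, one_mul, mul_one, Real.sqrt_mul (Nat.cast_nonneg _),
    Real.sqrt_mul (Nat.cast_nonneg _)]
  ring

/-- Grouping the shorter side keeps the longer one at full resolution, which yields `B * max d₁ d₂`
bits. -/
lemma exists_coding (hB : 0 < B) (hBd : B ≤ min d₁ d₂) :
    ∃ (d d' : ℕ) (φ : Fin d₁ × Fin d₂ → Fin d × Fin d'), d * d' = B * max d₁ d₂ ∧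
      (∀ k, d₁ * d₂ ≤ 2 * (d * d') * (Finset.univ.filter fun p => φ p = k).card) ∧
      ∀ c δ : ℝ, 0 ≤ c → 0 ≤ δ → ∀ s,
        nuclearNorm (signMatrix φ c δ s) ≤ √(d₁ * d₂) * (c + δ * √B) := by
  rcases le_total d₁ d₂ with h | h
  · rw [min_eq_left h] at hBd
    obtain ⟨f, hf⟩ := exists_balanced_map hB hBd
    refine ⟨B, d₂, fun p => (f p.1, p.2), by rw [max_eq_right h], fun k => ?_,
      fun c δ hc hδ s => nuclearNorm_signMatrix_row_le f hc hδ s⟩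
    have e : (Finset.univ.filter fun p : Fin d₁ × Fin d₂ => (f p.1, p.2) = k) =
        (Finset.univ.filter fun i => f i = k.1) ×ˢ {k.2} := by
      ext p
      simp [Prod.ext_iff, eq_comm]
    rw [e, Finset.card_product, Finset.card_singleton]
    nlinarith [Nat.mul_le_mul_right d₂ (hf k.1)]
  · rw [min_eq_right h] at hBd
    obtain ⟨f, hf⟩ := exists_balanced_map hB hBd
    refine ⟨d₁, B, fun p => (p.1, f p.2), by rw [max_eq_left h, mul_comm], fun k => ?_,
      fun c δ hc hδ s => nuclearNorm_signMatrix_col_le f hc hδ s⟩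
    have e : (Finset.univ.filter fun p : Fin d₁ × Fin d₂ => (p.1, f p.2) = k) =
        {k.1} ×ˢ (Finset.univ.filter fun j => f j = k.2) := by
      ext p
      simp [Prod.ext_iff, eq_comm, and_comm]
    rw [e, Finset.card_product, Finset.card_singleton]
    nlinarith [Nat.mul_le_mul_right d₁ (hf k.2)]

end Coding

/-! ### Bounds on the floor -/

section ErrorFloor

lemma errorFloor_le (C α r : ℝ) (d₁ d₂ m : ℕ) : errorFloor C α r d₁ d₂ m ≤ 1 / 256 := by
  rw [errorFloor]
  split_ifs
  · exact le_rfl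
  · exact min_le_left _ _

lemma sq_errorFloor_mul_le {C α r : ℝ} (hα : 0 ≤ α) (hr : 0 ≤ r) {d₁ d₂ m : ℕ}
    (h0 : 0 ≤ errorFloor C α r d₁ d₂ m) :
    errorFloor C α r d₁ d₂ m ^ 2 * m ≤ C ^ 2 * α ^ 3 * (r * (max d₁ d₂ : ℕ)) := by
  rcases Nat.eq_zero_or_pos m with rfl | hm
  · rw [Nat.cast_zero, mul_zero]
    positivity
  have hm' : (0 : ℝ) < m := by exact_mod_cast hm
  have hle : errorFloor C α r d₁ d₂ m ≤
      C * α ^ (3 / 2 : ℝ) * (r * (max d₁ d₂ : ℕ) / m) ^ (1 / 2 : ℝ) := by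
    rw [errorFloor, if_neg hm.ne']
    exact min_le_right _ _
  have h2 : errorFloor C α r d₁ d₂ m ^ 2 ≤ C ^ 2 * α ^ 3 * (r * (max d₁ d₂ : ℕ) / m) := by
    refine (pow_le_pow_left₀ h0 hle 2).trans (le_of_eq ?_)
    have e1 : (α ^ (3 / 2 : ℝ)) ^ 2 = α ^ 3 := by
      rw [← Real.rpow_natCast, ← Real.rpow_mul hα, ← Real.rpow_natCast]
      norm_num
    rw [← Real.sqrt_eq_rpow, mul_pow, mul_pow, e1, Real.sq_sqrt (by positivity)]
  calc _ ≤ C ^ 2 * α ^ 3 * (r * (max d₁ d₂ : ℕ) / m) * m := by gcongr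
    _ = _ := by field_simp

end ErrorFloor

end PoissonCompletion

theorem theorem3 :
    ∃ C₀ C₁ C₂ : ℝ, 0 < C₀ ∧ 0 < C₁ ∧ 0 < C₂ ∧
      ∀ (α β r : ℝ) (d₁ d₂ : ℕ),
        1 ≤ β → 2 * β ≤ α → 1 ≤ d₁ → 1 ≤ d₂ → 4 ≤ r →
        C₀ ≤ α ^ 2 * r * (max d₁ d₂ : ℕ) →
        ∀ (m : ℕ) (Ω₀ : Finset (Fin d₁ × Fin d₂)), Ω₀.card = m →
        C₁ * r * α ^ 2 / (min d₁ d₂ : ℕ) < PoissonCompletion.errorFloor C₂ α r d₁ d₂ m →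
        ∀ Mhat : (Ω₀ → ℕ) → Matrix (Fin d₁) (Fin d₂) ℝ,
          ∃ M ∈ PoissonCompletion.candidateSet α β r d₁ d₂,
            3 / 4 ≤ (PoissonCompletion.observationLaw M Ω₀).real
              {y | PoissonCompletion.errorFloor C₂ α r d₁ d₂ m ≤
                1 / ((d₁ : ℝ) * d₂) * PoissonCompletion.risk M (Mhat y)} := by
  open PoissonCompletion in
  refine ⟨1, 1, 1 / 200, one_pos, one_pos, by norm_num, ?_⟩
  intro α β r d₁ d₂ hβ hα hd₁ hd₂ hr _ m Ω₀ hm hfloor Mhat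
  have hα2 : 2 ≤ α := by linarith
  have hmin : (0 : ℝ) < (min d₁ d₂ : ℕ) := by exact_mod_cast lt_min hd₁ hd₂
  have hmax : (1 : ℝ) ≤ (max d₁ d₂ : ℕ) := by exact_mod_cast hd₁.trans (le_max_left _ _)
  rw [one_mul] at hfloor
  have hE0 : 0 < errorFloor (1 / 200) α r d₁ d₂ m := lt_of_le_of_lt (by positivity) hfloor
  have hE := errorFloor_le (1 / 200) α r d₁ d₂ m
  have hEm := sq_errorFloor_mul_le (C := 1 / 200) (by linarith : 0 ≤ α)
    (by linarith : 0 ≤ r) hE0.le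
  set E := errorFloor (1 / 200) α r d₁ d₂ m
  set D : ℝ := ((max d₁ d₂ : ℕ) : ℝ)
  have hε0 : 0 < √E := Real.sqrt_pos.2 hE0
  have hεE : √E ^ 2 = E := Real.sq_sqrt hE0.le
  have hε : √E ≤ 1 / 16 := Real.sqrt_le_iff.2 ⟨by norm_num, by linarith⟩
  -- The choice for which `4 * √E * √R = α * √r / 2`, half of the nuclear norm budget. The lower
  -- bound on the floor keeps `R` below `min d₁ d₂`.
  set R := r * α ^ 2 / (64 * E) with hR
  have hRE : 64 * E * R = r * α ^ 2 := by
    rw [hR]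
    field_simp
  have hR64 : 64 ≤ R := by
    rw [hR, le_div_iff₀ (by positivity)]
    nlinarith
  have hRmin : R ≤ (min d₁ d₂ : ℕ) := by
    rw [hR, div_le_iff₀ (by positivity)]
    rw [div_lt_iff₀ hmin] at hfloor
    nlinarith [mul_pos hE0 hmin]
  set B := ⌊R⌋₊
  have hBR : (B : ℝ) ≤ R := Nat.floor_le (by linarith)
  have hRB : R < B + 1 := Nat.lt_floor_add_one R
  have hB : 0 < B := Nat.floor_pos.2 (by linarith)
  have hBmin : B ≤ min d₁ d₂ := by exact_mod_cast hBR.trans hRmin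
  obtain ⟨e, e', φ, hcard, hφ, hnuc⟩ := exists_coding hB hBmin
  have hK : Fintype.card (Fin e × Fin e') = B * max d₁ d₂ := by simpa using hcard
  -- Since `√E ≤ 1 / 16` and `α ≥ 2`, the shift is at most `1 / 4 ≤ α / 8`.
  have hc : 7 / 8 * α ≤ α - 4 * √E := by linarith
  have hc0 : 0 < α - 4 * √E := by linarith
  have hinfo : (Ω₀.card : ℝ) * (4 * √E) ^ 2 / (α - 4 * √E) + 3 ≤
      (Fintype.card (Fin e × Fin e') : ℝ) / 4 := by
    rw [hK, hm, mul_pow, hεE, Nat.cast_mul]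
    have h1 : m * E ≤ 64 / 40000 * (R * D) * α := by
      refine le_of_mul_le_mul_left ?_ hE0
      calc E * (m * E) = E ^ 2 * m := by ring
        _ ≤ (1 / 200) ^ 2 * α ^ 3 * (r * D) := hEm
        _ = 1 / 40000 * (r * α ^ 2) * D * α := by ring
        _ = E * (64 / 40000 * (R * D) * α) := by rw [← hRE]; ring
    have h2 : m * (4 ^ 2 * E) / (α - 4 * √E) ≤ 1 / 25 * (R * D) := by
      rw [div_le_iff₀ hc0]
      have h3 : 0 ≤ R * D := by positivity
      nlinarith [mul_le_mul_of_nonneg_left hc h3]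
    have h4 : 64 ≤ R * D := by nlinarith
    -- As `R ≥ 64`, the floor loses less than half.
    have h5 : R * D / 2 ≤ B * D := by nlinarith
    linarith
  obtain ⟨s, hs⟩ := exists_signMatrix_risk_le φ
    (fun k => by simpa [hcard] using hφ k) hd₁ hd₂ hε0 (by linarith : 4 * √E < α - 4 * √E)
    Ω₀ hinfo Mhat
  rw [hεE] at hs
  have hentry : ∀ i j, β ≤ signMatrix φ (α - 4 * √E) (4 * √E) s i j ∧
      signMatrix φ (α - 4 * √E) (4 * √E) s i j ≤ α := fun i j => by
    simp only [signMatrix]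
    split_ifs <;> constructor <;> linarith
  refine ⟨_, ⟨fun i j => by linarith [(hentry i j).1], ?_, hentry⟩, hs⟩
  refine (hnuc _ _ hc0.le (by positivity) s).trans ?_
  -- `r ≥ 4` fits the constant part, at most `α`, into the other half of the budget.
  have hsr : 2 ≤ √r := Real.le_sqrt_of_sq_le (by linarith)
  have hsB : 4 * √E * √B ≤ α * √r / 2 := by
    refine le_of_sq_le_sq ?_ (by positivity)
    rw [mul_pow, mul_pow, hεE, Real.sq_sqrt (Nat.cast_nonneg _), div_pow, mul_pow,
      Real.sq_sqrt (by linarith)]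
    nlinarith [mul_le_mul_of_nonneg_left hBR hE0.le]
  rw [mul_assoc r, Real.sqrt_mul (by linarith : 0 ≤ r), ← mul_assoc, mul_comm (√(_ * _))]
  refine mul_le_mul_of_nonneg_right ?_ (Real.sqrt_nonneg _)
  nlinarith
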